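/- For $n \ge 1$ let $H_n = \sum_{i=1}^n \frac1i$ denote the $n$-th harmonic number, and let $\zeta(n) = \sum_{i=1}^\infty i^{-n}$ (for integers $n \ge 2$) denote the values of the Riemann zeta function. The double series $$S := \sum_{j,k=1}^\infty \frac{H_j\,(H_{k+1}-1)}{j\,k\,(k+1)\,(j+k)}$$ of nonnegative terms converges, and $$S = -4\zeta(2) - 2\zeta(3) + 4\zeta(2)\zeta(3) + 2\zeta(5) = 0.999222\ldots,$$ that is, $0.999222 \le S < 0.999223$. In particular $S \ne 1$. -/

import Mathlib

/-- The summand `H_j (H_{k+1} - 1) / (j k (k+1) (j+k))` of the double series, for positive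
integers `j = p.1` and `k = p.2`, where `H_n = ∑_{i=1}^n 1/i` is the harmonic number. -/
noncomputable def doubleTerm (p : ℕ+ × ℕ+) : ℝ :=
  ((harmonic (p.1 : ℕ) : ℚ) : ℝ) * (((harmonic ((p.2 : ℕ) + 1) : ℚ) : ℝ) - 1) /
    ((p.1 : ℝ) * (p.2 : ℝ) * ((p.2 : ℝ) + 1) * ((p.1 : ℝ) + (p.2 : ℝ)))

/-- The sum `S` of the double series over all pairs of positive integers. -/
noncomputable def doubleSum : ℝ := ∑' p : ℕ+ × ℕ+, doubleTerm p

/-! Write `A_k = ζ(2) + ∑_{r<k} H_r/r`. Partial fractions and Tonelli give `∑_j H_j/(j(j+k)) =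
A_k/k`, so `S = ∑_k (H_{k+1}-1) A_k/(k²(k+1))`. Since `1/(k²(k+1)) = 1/k² - 1/(k(k+1))`, this is `∑
H_k A_k/k² - ∑ H_{k+1} A_k/(k(k+1))` (`tsum_term_add`). Summation by parts evaluates the second sum
as `4ζ(2) + ∑ H_k/k² = 4ζ(2) + 2ζ(3)`.

The first sum is `2ζ(2)ζ(3)` plus a combination of multiple zeta values of weight five. Duality
(`pair_word_dual`, by connected sums) brings these to depth at most two. The product `ζ(2)ζ(3) =
ζ(2,3) + ζ(3,2) + ζ(5)` and `sum_formula` then give `2ζ(2)ζ(3) + 2ζ(5)`.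

The exact evaluation takes place in `ℝ≥0∞`, where rearrangement is free. Differences therefore
appear as additive identities, and summability follows from finiteness of the zeta values. Indices
start at zero: `n` stands for the integer `n + 1`. -/

open scoped ENNReal

namespace HarmonicSeries

/-! ### Reciprocals, triangular sums and telescoping. -/

/-- The weight `1 / (n + 1)`. -/
noncomputable def recip (n : ℕ) : ℝ≥0∞ := ((n : ℝ≥0∞) + 1)⁻¹

theorem recip_eq_coe (n : ℕ) : recip n = (((n : NNReal) + 1)⁻¹ : NNReal) := by
  rw [recip, ENNReal.coe_inv (by positivity)]; push_cast; rfl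

theorem recip_eq_ofReal (n : ℕ) : recip n = ENNReal.ofReal (1 / ((n : ℝ) + 1)) := by
  rw [one_div, ENNReal.ofReal_inv_of_pos (by positivity), ENNReal.ofReal_add (by positivity) (by positivity)]
  simp [recip]

theorem recip_zero : recip 0 = 1 := by simp [recip]

theorem recip_eq_mul_succ (n : ℕ) : recip n = recip (n + 1) * (1 + recip n) := by
  simp only [recip_eq_coe]
  norm_cast
  push_cast
  field_simp

theorem tsum_shift (f : ℕ → ℝ≥0∞) (n : ℕ) :
    ∑' m, f m = ∑ m ∈ Finset.range n, f m + ∑' j, f (n + j) := by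
  rw [← ENNReal.summable.sum_add_tsum_nat_add' (k := n)]
  simp only [add_comm]

/-- Tonelli for a triangular double sum. -/
theorem tsum_sum_range_mul (b c : ℕ → ℝ≥0∞) :
    ∑' n, (∑ l ∈ Finset.range n, b l) * c n = ∑' l, b l * ∑' j, c (l + 1 + j) := by
  have h1 (n : ℕ) : (∑ l ∈ Finset.range n, b l) * c n = ∑' l, if l < n then b l * c n else 0 := by
    rw [tsum_eq_sum (s := Finset.range n), Finset.sum_mul]
    · exact Finset.sum_congr rfl fun l hl => by simp [Finset.mem_range.1 hl]
    · intro l hl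
      simp [Finset.mem_range] at hl
      simp [hl]
  simp_rw [h1]
  rw [ENNReal.tsum_comm]
  refine tsum_congr fun l => ?_
  rw [tsum_shift _ (l + 1), Finset.sum_eq_zero, zero_add, ← ENNReal.tsum_mul_left]
  · exact tsum_congr fun j => by rw [if_pos (by omega)]
  · intro m hm
    rw [if_neg (by simp at hm; omega)]

theorem tsum_sum_range_succ_mul (b c : ℕ → ℝ≥0∞) :
    ∑' n, (∑ l ∈ Finset.range (n + 1), b l) * c n = ∑' l, b l * ∑' j, c (l + j) := by
  simp_rw [Finset.sum_range_succ, add_mul]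
  rw [ENNReal.tsum_add, tsum_sum_range_mul, ← ENNReal.tsum_add]
  refine tsum_congr fun l => ?_
  rw [tsum_shift (fun j => c (l + j)) 1, ← mul_add]
  simp only [Finset.sum_range_one, add_zero]
  rw [add_comm]
  simp only [add_assoc]

theorem tsum_mul_tsum_split (a b : ℕ → ℝ≥0∞) :
    (∑' m, a m) * ∑' n, b n = ∑' n, (∑ m ∈ Finset.range n, a m) * b n
      + ∑' m, (∑ n ∈ Finset.range m, b n) * a m + ∑' n, a n * b n := by
  have h1 : (∑' m, a m) * ∑' n, b n = ∑' n, (∑ m ∈ Finset.range n, a m) * b n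
      + ∑' n, b n * ∑' j, a (n + j) := by
    rw [← ENNReal.tsum_mul_left, ← ENNReal.tsum_add]
    refine tsum_congr fun n => ?_
    rw [tsum_shift a n]
    ring
  rw [h1, ← tsum_sum_range_succ_mul, add_assoc]
  congr 1
  rw [← ENNReal.tsum_add]
  refine tsum_congr fun n => ?_
  rw [Finset.sum_range_succ]
  ring

/-- A telescoping series with nonnegative terms. -/
theorem tsum_of_telescope {f : ℕ → ℝ≥0∞} {u : ℕ → ℝ} (hf : ∀ n, f n = ENNReal.ofReal (u n - u (n + 1)))
    (hu : Antitone u) (h0 : Filter.Tendsto u Filter.atTop (nhds 0)) :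
    ∑' n, f n = ENNReal.ofReal (u 0) := by
  have hs : HasSum (fun n => u n - u (n + 1)) (u 0) := by
    rw [hasSum_iff_tendsto_nat_of_nonneg fun n => sub_nonneg.2 (hu (Nat.le_succ n))]
    simp_rw [Finset.sum_range_sub']
    simpa using h0.const_sub (u 0)
  simp_rw [hf]
  rw [← ENNReal.ofReal_tsum_of_nonneg (fun n => sub_nonneg.2 (hu (Nat.le_succ n))) hs.summable, hs.tsum_eq]

theorem tsum_recip_mul_recip_succ (i : ℕ) :
    ∑' j, recip (i + j) * recip (i + j + 1) = recip i := by
  rw [tsum_of_telescope (u := fun n => 1 / (((i + n : ℕ) : ℝ) + 1))]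
  · simp [recip_eq_ofReal]
  · intro n
    simp only [recip_eq_ofReal]
    rw [← ENNReal.ofReal_mul (by positivity)]
    congr 1
    push_cast
    field_simp
    ring
  · intro a b hab
    dsimp only
    gcongr
  · have := (tendsto_one_div_add_atTop_nhds_zero_nat (𝕜 := ℝ)).comp (Filter.tendsto_add_atTop_nat i)
    refine this.congr fun n => ?_
    simp [add_comm]

/-- The partial fraction of `1/(a(a+b))`, with `1/a - 1/(a+b)` replaced by its telescoping sum to
avoid subtraction. -/
theorem recip_mul_recip_add (n k : ℕ) : recip n * recip (n + k + 1) =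
    recip k * ∑ r ∈ Finset.range (k + 1), recip (n + r) * recip (n + r + 1) := by
  have h (k : ℕ) : ∑ r ∈ Finset.range (k + 1), recip (n + r) * recip (n + r + 1)
      = (k + 1) * (recip n * recip (n + k + 1)) := by
    induction k with
    | zero => simp
    | succ k ih =>
      rw [Finset.sum_range_succ, ih]
      simp only [recip_eq_coe]
      norm_cast
      push_cast
      field_simp
      ring
  have hk : recip k * ((k : ℝ≥0∞) + 1) = 1 :=
    ENNReal.inv_mul_cancel (by simp) (by finiteness)
  rw [h, ← mul_assoc, hk, one_mul]

theorem tsum_recip_mul_recip_add (i k : ℕ) :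
    ∑' j, recip (i + j) * recip (i + j + k + 1)
      = recip k * ∑ r ∈ Finset.range (k + 1), recip (i + r) := by
  simp_rw [recip_mul_recip_add]
  rw [ENNReal.tsum_mul_left, Summable.tsum_finsetSum fun _ _ => ENNReal.summable]
  congr 1
  refine Finset.sum_congr rfl fun r _ => ?_
  rw [← tsum_recip_mul_recip_succ]
  refine tsum_congr fun j => ?_
  rw [add_right_comm]

/-! ### The inner sum over `j`. -/

/-- The harmonic number `H_{n+1}`. -/
noncomputable def harm (n : ℕ) : ℝ≥0∞ := ∑ l ∈ Finset.range (n + 1), recip l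

theorem harm_zero : harm 0 = 1 := by simp [harm, recip_zero]

theorem harm_succ (n : ℕ) : harm (n + 1) = harm n + recip (n + 1) :=
  Finset.sum_range_succ _ _

theorem tsum_recip_mul_recip_add_zero (k : ℕ) :
    ∑' j, recip j * recip (j + k + 1) = recip k * harm k := by
  simpa [harm] using tsum_recip_mul_recip_add 0 k

/-- The value `ζ(k)`. -/
noncomputable def zetaSum (k : ℕ) : ℝ≥0∞ := ∑' n, recip n ^ k

/-- `ζ(2) + ∑_{r ≤ k} H_r / r`. -/
noncomputable def innerSum (k : ℕ) : ℝ≥0∞ :=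
  zetaSum 2 + ∑ r ∈ Finset.range k, recip r * harm r

theorem innerSum_succ (k : ℕ) : innerSum (k + 1) = innerSum k + recip k * harm k := by
  rw [innerSum, Finset.sum_range_succ, ← add_assoc, innerSum]

/-- Unfolding `H_j` and exchanging sums leaves `∑_l (1/l) ∑_r 1/(l+r)`. The term `r = 0` gives
`ζ(2)`, each `r ≥ 1` gives `H_r/r`. -/
theorem tsum_harm_mul (k : ℕ) :
    ∑' j, harm j * (recip j * recip (j + k + 1)) = recip k * innerSum k := by
  simp only [harm]
  rw [tsum_sum_range_succ_mul]
  simp_rw [tsum_recip_mul_recip_add, mul_left_comm _ (recip k)]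
  rw [ENNReal.tsum_mul_left]
  congr 1
  simp_rw [Finset.mul_sum]
  rw [Summable.tsum_finsetSum fun _ _ => ENNReal.summable, Finset.sum_range_succ', innerSum, add_comm]
  congr 1
  · exact tsum_congr fun n => by simp [sq]
  · exact Finset.sum_congr rfl fun r _ => tsum_recip_mul_recip_add_zero r

theorem tsum_harm_mul_recip_mul_recip_succ :
    ∑' j, harm j * (recip j * recip (j + 1)) = zetaSum 2 := by
  simpa [recip_zero, innerSum] using tsum_harm_mul 0

/-! ### Summation by parts and removal of the factor `1/(k+1)`. -/

/-- Discrete product rule. Once the product is a partial sum, the weights `1/(k(k+1))` have tails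
that telescope. -/
theorem harm_succ_mul_innerSum (k : ℕ) : harm (k + 1) * innerSum k =
    zetaSum 2 + ∑ l ∈ Finset.range (k + 1), innerSum l * recip (l + 1)
      + ∑ l ∈ Finset.range k, recip l * (harm l * harm (l + 1)) := by
  induction k with
  | zero => simp [innerSum, harm_succ, harm_zero]; ring
  | succ k ih =>
    rw [Finset.sum_range_succ _ (k + 1), Finset.sum_range_succ (fun l => recip l * _) k,
      harm_succ (k + 1), add_mul]
    nth_rw 1 [innerSum_succ]
    rw [mul_add, ih]
    ring

theorem harm_mul_harm_succ (k : ℕ) : harm k * harm (k + 1) =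
    ∑ l ∈ Finset.range (k + 1), harm l * (recip l + recip (l + 1)) := by
  induction k with
  | zero => simp [harm_succ, harm_zero, recip_zero]
  | succ k ih =>
    rw [Finset.sum_range_succ, ← ih, harm_succ (k + 1)]
    calc harm (k + 1) * (harm (k + 1) + recip (k + 1 + 1))
        = harm (k + 1) * (harm k + recip (k + 1) + recip (k + 1 + 1)) := by rw [← harm_succ k]
      _ = _ := by ring

theorem tsum_harm_mul_harm_succ : ∑' k, harm k * harm (k + 1) * (recip k * recip (k + 1)) =
    zetaSum 2 + ∑' k, harm k * recip k ^ 2 := by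
  simp_rw [harm_mul_harm_succ]
  rw [tsum_sum_range_succ_mul]
  simp_rw [tsum_recip_mul_recip_succ]
  rw [← tsum_harm_mul_recip_mul_recip_succ, ← ENNReal.tsum_add]
  exact tsum_congr fun n => by ring

theorem tsum_innerSum : ∑' k, innerSum k * (recip k * recip (k + 1)) = 2 * zetaSum 2 := by
  simp_rw [innerSum, add_mul]
  have h := tsum_recip_mul_recip_succ 0
  simp only [zero_add, recip_zero] at h
  rw [ENNReal.tsum_add, tsum_sum_range_mul, ENNReal.tsum_mul_left, h]
  simp_rw [tsum_recip_mul_recip_succ]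
  rw [mul_one, two_mul]
  congr 1
  rw [← tsum_harm_mul_recip_mul_recip_succ]
  exact tsum_congr fun n => by ring

theorem tsum_harm_succ_mul_innerSum :
    ∑' k, harm (k + 1) * innerSum k * (recip k * recip (k + 1)) =
      4 * zetaSum 2 + ∑' k, harm k * recip k ^ 2 := by
  have h := tsum_recip_mul_recip_succ 0
  simp only [zero_add, recip_zero] at h
  simp_rw [harm_succ_mul_innerSum, add_mul]
  rw [ENNReal.tsum_add, ENNReal.tsum_add, tsum_sum_range_mul, tsum_sum_range_succ_mul,
    ENNReal.tsum_mul_left, h]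
  simp_rw [tsum_recip_mul_recip_succ]
  have h1 : ∑' l, innerSum l * recip (l + 1) * recip l = 2 * zetaSum 2 := by
    rw [← tsum_innerSum]
    exact tsum_congr fun n => by ring
  have h2 : ∑' l, recip l * (harm l * harm (l + 1)) * recip (l + 1) =
      zetaSum 2 + ∑' k, harm k * recip k ^ 2 := by
    rw [← tsum_harm_mul_harm_succ]
    exact tsum_congr fun n => by ring
  rw [h1, h2]
  ring

/-- The summand, with indices shifted to start at zero. -/
noncomputable def term (j k : ℕ) : ℝ≥0∞ :=
  harm j * (∑ l ∈ Finset.range (k + 1), recip (l + 1)) *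
    (recip j * recip k * recip (k + 1) * recip (j + k + 1))

theorem tsum_term : ∑' k, ∑' j, term j k =
    ∑' k, (∑ l ∈ Finset.range (k + 1), recip (l + 1)) * (recip k ^ 2 * recip (k + 1) * innerSum k) := by
  refine tsum_congr fun k => ?_
  have : (∑ l ∈ Finset.range (k + 1), recip (l + 1)) * (recip k ^ 2 * recip (k + 1) * innerSum k)
    = ((∑ l ∈ Finset.range (k + 1), recip (l + 1)) * recip k * recip (k + 1)) *
      (recip k * innerSum k) := by ring
  rw [this, ← tsum_harm_mul, ← ENNReal.tsum_mul_left]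
  exact tsum_congr fun j => by rw [term]; ring

theorem tsum_term_add : (∑' k, ∑' j, term j k) + (4 * zetaSum 2 + ∑' k, harm k * recip k ^ 2) =
    ∑' k, harm k * innerSum k * recip k ^ 2 := by
  rw [tsum_term, ← tsum_harm_succ_mul_innerSum, ← ENNReal.tsum_add]
  refine tsum_congr fun k => ?_
  have e1 : harm k = 1 + ∑ l ∈ Finset.range k, recip (l + 1) := by
    rw [harm, Finset.sum_range_succ', recip_zero, add_comm]
  rw [harm_succ, e1, Finset.sum_range_succ]
  set s := ∑ l ∈ Finset.range k, recip (l + 1)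
  have e2 := recip_eq_mul_succ k
  set p := recip (k + 1)
  set q := recip k
  calc (s + p) * (q ^ 2 * p * innerSum k) + (1 + s + p) * innerSum k * (q * p)
      = innerSum k * q * ((s + p) * (p * (1 + q)) + p) := by ring
    _ = innerSum k * q * ((s + p) * q + p) := by rw [← e2]
    _ = innerSum k * q * (s * q + p * (1 + q)) := by ring
    _ = (1 + s) * innerSum k * q ^ 2 := by rw [← e2]; ring

/-! ### Operators encoding multiple zeta values. -/

/-- Multiplication by `1 / (n + 1)`. -/
noncomputable def mulRecip (f : ℕ → ℝ≥0∞) (n : ℕ) : ℝ≥0∞ := f n * recip n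

/-- The weighted tail sum `∑_{a > n} f(a) / (a + 1)`. -/
noncomputable def tailSum (f : ℕ → ℝ≥0∞) (n : ℕ) : ℝ≥0∞ :=
  ∑' j, f (n + 1 + j) * recip (n + 1 + j)

/-- The weighted partial sum `∑_{l < n} f(l) / (l + 1)`. -/
noncomputable def partSum (f : ℕ → ℝ≥0∞) (n : ℕ) : ℝ≥0∞ :=
  ∑ l ∈ Finset.range n, f l * recip l

/-- The pairing `∑_n f(n) g(n) / (n + 1)`. -/
noncomputable def pair (f g : ℕ → ℝ≥0∞) : ℝ≥0∞ := ∑' n, f n * g n * recip n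

theorem pair_tailSum (f g : ℕ → ℝ≥0∞) : pair f (tailSum g) = pair (partSum f) g := by
  simp only [pair, tailSum, partSum, mul_assoc]
  rw [tsum_sum_range_mul]
  exact tsum_congr fun n => by ring

theorem pair_mulRecip (f g : ℕ → ℝ≥0∞) : pair f (mulRecip g) = pair (mulRecip f) g :=
  tsum_congr fun n => by simp only [mulRecip]; ring

/-- `mulRecip` for `true` and `tailSum` for `false`. -/
noncomputable def letter : Bool → (ℕ → ℝ≥0∞) → ℕ → ℝ≥0∞
  | true => mulRecip
  | false => tailSum

/-- The operator attached to a word in the two letters. -/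
noncomputable def word : List Bool → (ℕ → ℝ≥0∞) → ℕ → ℝ≥0∞
  | [], f => f
  | b :: w, f => letter b (word w f)

theorem word_append (v w : List Bool) (f : ℕ → ℝ≥0∞) : word (v ++ w) f = word v (word w f) := by
  induction v with
  | nil => rfl
  | cons b v ih => simp [word, ih]

theorem letter_tsum_mul (b : Bool) (F : ℕ → ℕ → ℝ≥0∞) (c : ℕ → ℝ≥0∞) :
    letter b (fun m => ∑' i, F i m * c i) = fun m => ∑' i, letter b (F i) m * c i := by
  funext m
  cases b
  · simp only [letter, tailSum, ← ENNReal.tsum_mul_right]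
    rw [ENNReal.tsum_comm]
    exact tsum_congr fun i => tsum_congr fun j => by ring
  · simp only [letter, mulRecip, ← ENNReal.tsum_mul_right]
    exact tsum_congr fun i => by ring

theorem word_tsum_mul (w : List Bool) (F : ℕ → ℕ → ℝ≥0∞) (c : ℕ → ℝ≥0∞) :
    word w (fun m => ∑' i, F i m * c i) = fun m => ∑' i, word w (F i) m * c i := by
  induction w with
  | nil => rfl
  | cons b w ih => simp only [word, ih, letter_tsum_mul]

theorem letter_mul (b : Bool) (f : ℕ → ℝ≥0∞) (c : ℝ≥0∞) :
    letter b (fun m => f m * c) = fun m => letter b f m * c := by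
  funext m
  cases b
  · simp only [letter, tailSum, ← ENNReal.tsum_mul_right]
    exact tsum_congr fun j => by ring
  · simp only [letter, mulRecip]
    ring

theorem letter_comm (a b : Bool) (F : ℕ → ℕ → ℝ≥0∞) (m n : ℕ) :
    letter a (fun m => letter b (F m) n) m = letter b (fun n => letter a (fun m => F m n) m) n := by
  cases b
  · exact congrFun (letter_tsum_mul a (fun j m => F m (n + 1 + j)) fun j => recip (n + 1 + j)) m
  · exact congrFun (letter_mul a (fun m => F m n) (recip n)) m

theorem letter_word_comm (a : Bool) (w : List Bool) (F : ℕ → ℕ → ℝ≥0∞) (m n : ℕ) :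
    letter a (fun m => word w (F m) n) m = word w (fun n => letter a (fun m => F m n) m) n := by
  induction w generalizing n with
  | nil => rfl
  | cons b w ih =>
    simp only [word]
    rw [letter_comm]
    simp only [ih]

/-! ### Duality by connected sums. -/

/-- The connector `m! n! / (m + n)!`, with indices shifted by one. -/
noncomputable def connectorReal (m n : ℕ) : ℝ :=
  (m + 1).factorial * (n + 1).factorial / (m + n + 2).factorial

theorem connectorReal_pos (m n : ℕ) : 0 < connectorReal m n := by
  unfold connectorReal; positivity

theorem connectorReal_comm (m n : ℕ) : connectorReal m n = connectorReal n m := by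
  rw [connectorReal, connectorReal, add_comm m n, mul_comm]

theorem connectorReal_succ (m n : ℕ) :
    connectorReal (m + 1) n = connectorReal m n * ((m + 2) / (m + n + 3)) := by
  simp only [connectorReal]
  rw [show m + 1 + n + 2 = (m + n + 2) + 1 by ring, Nat.factorial_succ (m + 1),
    Nat.factorial_succ (m + n + 2)]
  push_cast
  field_simp
  ring

theorem connectorReal_le (m n : ℕ) : connectorReal m n ≤ 1 / (m + 2) := by
  induction m with
  | zero =>
    rw [connectorReal, zero_add, zero_add, Nat.factorial_succ (n + 1)]
    push_cast
    rw [div_le_div_iff₀ (by positivity) (by positivity), Nat.factorial_one, Nat.cast_one]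
    nlinarith [(by positivity : (0 : ℝ) < (n + 1).factorial), (by positivity : (0 : ℝ) ≤ n)]
  | succ m ih =>
    rw [connectorReal_succ]
    calc connectorReal m n * ((m + 2) / (m + n + 3))
        ≤ 1 / (m + 2) * ((m + 2) / (m + 3)) := by
          gcongr
          simp
      _ = _ := by push_cast; field_simp; ring

/-- The connector in `ℝ≥0∞`. -/
noncomputable def connector (m n : ℕ) : ℝ≥0∞ := ENNReal.ofReal (connectorReal m n)

theorem connector_comm (m n : ℕ) : connector m n = connector n m := by
  rw [connector, connectorReal_comm, connector]

/-- In unshifted indices, `C(m,n)/n - C(m+1,n)/n = C(m+1,n)/(m+1)`, so the tail telescopes;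
`connectorReal_le` kills the boundary term. -/
theorem tailSum_connector (m n : ℕ) :
    tailSum (fun m => connector m n) m = connector m n * recip n := by
  have hs (j : ℕ) : connectorReal (m + (j + 1)) n = connectorReal (m + j) n *
      (((m + j : ℕ) + 2) / ((m + j : ℕ) + n + 3)) := by
    rw [← add_assoc, connectorReal_succ]
  rw [tailSum, tsum_of_telescope (u := fun j => connectorReal (m + j) n / (n + 1))]
  · rw [recip_eq_ofReal, connector, ← ENNReal.ofReal_mul (connectorReal_pos m n).le]
    congr 1
    simp [div_eq_mul_inv]
  · intro j
    rw [recip_eq_ofReal, connector, ← ENNReal.ofReal_mul (connectorReal_pos _ n).le]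
    congr 1
    rw [add_right_comm m 1 j, add_assoc m j 1, hs]
    push_cast
    field_simp
    ring
  · refine antitone_nat_of_succ_le fun j => ?_
    rw [hs]
    gcongr
    refine mul_le_of_le_one_right (connectorReal_pos _ _).le ?_
    rw [div_le_one (by positivity)]
    have : (0 : ℝ) ≤ n := by positivity
    linarith
  · have h := (tendsto_one_div_add_atTop_nhds_zero_nat (𝕜 := ℝ))
    refine squeeze_zero (fun j => ?_) (fun j => ?_) h
    · exact div_nonneg (connectorReal_pos _ _).le (by positivity)
    · calc connectorReal (m + j) n / (n + 1) ≤ connectorReal (m + j) n :=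
            div_le_self (connectorReal_pos _ _).le (by simp)
        _ ≤ 1 / ((m + j : ℕ) + 2) := connectorReal_le _ _
        _ ≤ 1 / (j + 1) := by
            gcongr
            · simp
            · norm_num

theorem letter_connector (b : Bool) (m n : ℕ) :
    letter b (fun m => connector m n) m = letter (!b) (connector m) n := by
  cases b
  · exact tailSum_connector m n
  · change connector m n * recip m = tailSum (connector m) n
    rw [connector_comm, ← tailSum_connector]
    simp only [connector_comm]

/-- Each letter crosses the connector and flips. The outermost letter in `m` crosses last and lands
innermost in `n`, which reverses the word. -/
theorem word_connector (w : List Bool) (m n : ℕ) :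
    word w (fun m => connector m n) m = word (w.reverse.map (!·)) (connector m) n := by
  induction w generalizing m n with
  | nil => rfl
  | cons b w ih =>
    simp only [word, List.reverse_cons, List.map_append, word_append, List.map_cons, List.map_nil]
    rw [funext fun m => ih m n, letter_word_comm]
    simp only [letter_connector]

theorem tsum_connector_mul_recip (m : ℕ) : ∑' i, connector m i * recip i = recip m := by
  -- The transport relation only covers integers greater than 1, so the first term is added
  -- separately: `1/(m+1) + 1/(m(m+1)) = 1/m`.
  rw [tsum_shift _ 1]
  have h := tailSum_connector 0 m
  simp only [tailSum, zero_add, connector_comm _ m] at h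
  rw [h, Finset.sum_range_one]
  simp only [recip_eq_ofReal, connector]
  rw [← ENNReal.ofReal_mul (connectorReal_pos _ _).le,
    ← ENNReal.ofReal_mul (connectorReal_pos _ _).le,
    ← ENNReal.ofReal_add (mul_nonneg (connectorReal_pos _ _).le (by positivity))
      (mul_nonneg (connectorReal_pos _ _).le (by positivity))]
  congr 1
  rw [connectorReal, add_zero, zero_add, Nat.factorial_succ (m + 1)]
  push_cast
  field_simp
  simp

/-- Duality for multiple zeta values. -/
theorem pair_word_dual (w : List Bool) :
    pair 1 (word w (mulRecip 1)) = pair 1 (word (w.reverse.map (!·)) (mulRecip 1)) := by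
  have h1 : mulRecip 1 = fun m => ∑' i, connector m i * recip i := by
    funext m
    rw [tsum_connector_mul_recip, mulRecip, Pi.one_apply, one_mul]
  have h2 : mulRecip 1 = fun m => ∑' i, connector i m * recip i := by
    rw [h1]; simp only [connector_comm]
  simp only [pair, Pi.one_apply, one_mul]
  nth_rw 1 [h1]
  rw [h2, word_tsum_mul, word_tsum_mul]
  simp only [← ENNReal.tsum_mul_right]
  rw [ENNReal.tsum_comm]
  refine tsum_congr fun i => tsum_congr fun m => ?_
  rw [word_connector]
  exact mul_right_comm _ _ _

/-! ### Quasi-shuffle expansion and evaluation in weight five. -/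

theorem pair_add_left (f g h : ℕ → ℝ≥0∞) : pair (f + g) h = pair f h + pair g h := by
  simp only [pair, ← ENNReal.tsum_add, Pi.add_apply, add_mul]

theorem pair_nsmul_left (k : ℕ) (f h : ℕ → ℝ≥0∞) : pair (k • f) h = k * pair f h := by
  simp only [pair, ← ENNReal.tsum_mul_left, Pi.smul_apply, nsmul_eq_mul, mul_assoc]

theorem partSum_succ (f : ℕ → ℝ≥0∞) (n : ℕ) : partSum f (n + 1) = partSum f n + f n * recip n :=
  Finset.sum_range_succ _ _

/-- The quasi-shuffle product of partial sums. -/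
theorem partSum_mul_partSum (f g : ℕ → ℝ≥0∞) : partSum f * partSum g =
    partSum (f * partSum g) + partSum (g * partSum f) + partSum (mulRecip (f * g)) := by
  funext n
  induction n with
  | zero => simp [partSum]
  | succ n ih =>
    simp only [Pi.mul_apply, Pi.add_apply, partSum_succ, mulRecip] at ih ⊢
    calc _ = partSum f n * partSum g n + f n * partSum g n * recip n +
          g n * partSum f n * recip n + f n * g n * recip n * recip n := by ring
      _ = _ := by rw [ih]; ring

theorem partSum_add (f g : ℕ → ℝ≥0∞) : partSum (f + g) = partSum f + partSum g := by
  funext n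
  simp [partSum, add_mul, Finset.sum_add_distrib]

theorem mulRecip_add (f g : ℕ → ℝ≥0∞) : mulRecip (f + g) = mulRecip f + mulRecip g := by
  funext n
  simp [mulRecip, add_mul]

theorem mulRecip_mul (f g : ℕ → ℝ≥0∞) : mulRecip f * g = mulRecip (f * g) := by
  funext n
  simp only [mulRecip, Pi.mul_apply]
  ring

theorem harm_eq : harm = partSum 1 + mulRecip 1 := by
  funext n
  simp [harm, partSum, mulRecip, Finset.sum_range_succ]

/-- Euler's `ζ(2,1) = ζ(3)`. With the largest summation index first, the next four are `ζ(2,1,1,1) =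
ζ(5)`, `ζ(2,1,2) = ζ(2,3)`, `ζ(2,2,1) = ζ(3,2)` and `ζ(3,1,1) = ζ(4,1)`. -/
theorem pair_one_dual_one : pair (partSum 1) (mulRecip 1) = pair 1 (mulRecip (mulRecip 1)) := by
  rw [← pair_tailSum]
  exact pair_word_dual [false]

theorem pair_partSum3 : pair (partSum (partSum (partSum 1))) (mulRecip 1) =
    pair 1 (mulRecip (mulRecip (mulRecip (mulRecip 1)))) := by
  simp only [← pair_tailSum]
  exact pair_word_dual [false, false, false]

theorem pair_partSum_partSum_mulRecip : pair (partSum (partSum (mulRecip 1))) (mulRecip 1) =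
    pair (partSum (mulRecip (mulRecip 1))) (mulRecip 1) := by
  simp only [← pair_tailSum, ← pair_mulRecip]
  exact pair_word_dual [true, false, false]

theorem pair_partSum_mulRecip_partSum : pair (partSum (mulRecip (partSum 1))) (mulRecip 1) =
    pair (partSum (mulRecip 1)) (mulRecip (mulRecip 1)) := by
  simp only [← pair_tailSum, ← pair_mulRecip]
  exact pair_word_dual [false, true, false]

theorem pair_mulRecip_partSum_partSum : pair (mulRecip (partSum (partSum 1))) (mulRecip 1) =
    pair (partSum 1) (mulRecip (mulRecip (mulRecip 1))) := by
  simp only [← pair_tailSum, ← pair_mulRecip]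
  exact pair_word_dual [false, false, true]

theorem pair_one_mulRecip2 : pair 1 (mulRecip (mulRecip 1)) = zetaSum 3 :=
  tsum_congr fun n => by simp only [mulRecip, Pi.one_apply]; ring

theorem pair_one_mulRecip4 :
    pair 1 (mulRecip (mulRecip (mulRecip (mulRecip 1)))) = zetaSum 5 :=
  tsum_congr fun n => by simp only [mulRecip, Pi.one_apply]; ring

theorem tsum_harm_mul_recip_sq : ∑' k, harm k * recip k ^ 2 = 2 * zetaSum 3 := by
  have : ∑' k, harm k * recip k ^ 2 = pair harm (mulRecip 1) :=
    tsum_congr fun n => by simp only [mulRecip, Pi.one_apply]; ring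
  rw [this, harm_eq, pair_add_left, pair_one_dual_one, ← pair_mulRecip, pair_one_mulRecip2, two_mul]

theorem harm_mul_partSum_harm : harm * partSum harm =
    3 • partSum (partSum (partSum 1)) + 2 • partSum (partSum (mulRecip 1))
      + 2 • partSum (mulRecip (partSum 1)) + partSum (mulRecip (mulRecip 1))
      + mulRecip (partSum (partSum 1)) + mulRecip (partSum (mulRecip 1)) := by
  have h1 : partSum 1 * partSum (partSum 1) = 3 • partSum (partSum (partSum 1))
      + partSum (partSum (mulRecip 1)) + partSum (mulRecip (partSum 1)) := by
    simp only [partSum_mul_partSum, partSum_add, one_mul, mul_one]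
    ring
  have h2 : partSum 1 * partSum (mulRecip 1) = partSum (partSum (mulRecip 1))
      + partSum (mulRecip (partSum 1)) + partSum (mulRecip (mulRecip 1)) := by
    rw [partSum_mul_partSum, one_mul, one_mul, mulRecip_mul, one_mul]
  rw [harm_eq, partSum_add, add_mul, mul_add, h1, h2, mulRecip_mul, one_mul, mulRecip_add]
  ring

theorem pair_harm_mul_partSum_harm : pair (harm * partSum harm) (mulRecip 1) =
    3 * zetaSum 5 + 3 * pair (partSum (mulRecip (mulRecip 1))) (mulRecip 1)
      + 3 * pair (partSum (mulRecip 1)) (mulRecip (mulRecip 1))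
      + pair (partSum 1) (mulRecip (mulRecip (mulRecip 1))) := by
  have h : pair (mulRecip (partSum (mulRecip 1))) (mulRecip 1) =
    pair (partSum (mulRecip 1)) (mulRecip (mulRecip 1)) := (pair_mulRecip _ _).symm
  rw [harm_mul_partSum_harm]
  simp only [pair_add_left, pair_nsmul_left, pair_partSum3, pair_partSum_partSum_mulRecip,
    pair_partSum_mulRecip_partSum, pair_mulRecip_partSum_partSum, pair_one_mulRecip4, h]
  push_cast
  ring

theorem zetaSum_ne_top {k : ℕ} (hk : 2 ≤ k) : zetaSum k ≠ ⊤ := by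
  have h : zetaSum 2 ≠ ⊤ := by
    rw [zetaSum, tsum_shift _ 1]
    have : ∑' j, recip (1 + j) ^ 2 ≤ 1 := by
      have := tsum_recip_mul_recip_succ 0
      simp only [zero_add, recip_zero] at this
      rw [← this]
      refine ENNReal.tsum_le_tsum fun j => ?_
      rw [add_comm 1 j, sq]
      gcongr
      rw [recip, recip]
      gcongr
      simp
    simp only [Finset.sum_range_one, recip_zero, one_pow]
    exact (ENNReal.add_lt_top.2 ⟨ENNReal.one_lt_top, this.trans_lt ENNReal.one_lt_top⟩).ne
  refine ne_top_of_le_ne_top h (ENNReal.tsum_le_tsum fun n => ?_)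
  refine pow_le_pow_of_le_one zero_le ?_ hk
  rw [recip, ENNReal.inv_le_one]
  simp

theorem zetaSum_two_mul_zetaSum_three : zetaSum 2 * zetaSum 3 =
    pair (partSum (mulRecip (mulRecip 1))) (mulRecip 1)
      + pair (partSum (mulRecip 1)) (mulRecip (mulRecip 1)) + zetaSum 5 := by
  rw [zetaSum, zetaSum, tsum_mul_tsum_split, zetaSum, add_comm (∑' n, _ * recip n ^ 3)]
  refine congrArg₂ _ (congrArg₂ _ ?_ ?_) ?_ <;> refine tsum_congr fun n => ?_
  · simp only [mulRecip, Pi.one_apply, partSum]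
    ring_nf
  · simp only [mulRecip, Pi.one_apply, partSum]
    ring_nf
  · ring

/-- The sum formula for double zeta values of weight five. -/
theorem sum_formula :
    pair (partSum 1) (mulRecip (mulRecip (mulRecip 1)))
      + pair (partSum (mulRecip 1)) (mulRecip (mulRecip 1))
      + pair (partSum (mulRecip (mulRecip 1))) (mulRecip 1) = zetaSum 5 := by
  -- Partial fractions of `1/(l³ d m)` with `m = l + d`. Summed, the first and fourth terms both
  -- give `ζ(4,1)`, and the right side gives `ζ(4,1) + ζ(5)`.
  have key (l d : ℕ) : recip l * recip (l + 1 + d) ^ 4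
      + recip l ^ 2 * recip (l + 1 + d) ^ 3 + recip l ^ 3 * recip (l + 1 + d) ^ 2
      + recip d * recip (d + 1 + l) ^ 4 = recip l ^ 3 * (recip d * recip (d + l + 1)) := by
    rw [show d + 1 + l = l + 1 + d by ring, show d + l + 1 = l + 1 + d by ring]
    simp only [recip_eq_coe]
    norm_cast
    push_cast
    field_simp
    ring
  have hp (f g : ℕ → ℝ≥0∞) (a b : ℕ) (hf : ∀ n, f n * recip n = recip n ^ a)
      (hg : ∀ n, g n * recip n = recip n ^ b) :
      pair (partSum f) g = ∑' l, ∑' d, recip l ^ a * recip (l + 1 + d) ^ b := by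
    rw [← pair_tailSum]
    refine tsum_congr fun l => ?_
    rw [mul_right_comm, hf, tailSum, ← ENNReal.tsum_mul_left]
    simp only [hg]
  have h1 := hp 1 (mulRecip (mulRecip (mulRecip 1))) 1 4 (fun n => by simp)
    (fun n => by simp only [mulRecip, Pi.one_apply]; ring)
  have h2 := hp (mulRecip 1) (mulRecip (mulRecip 1)) 2 3
    (fun n => by simp only [mulRecip, Pi.one_apply]; ring)
    (fun n => by simp only [mulRecip, Pi.one_apply]; ring)
  have h3 := hp (mulRecip (mulRecip 1)) (mulRecip 1) 3 2
    (fun n => by simp only [mulRecip, Pi.one_apply]; ring)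
    (fun n => by simp only [mulRecip, Pi.one_apply]; ring)
  simp only [pow_one] at h1
  have h4 := h1
  rw [ENNReal.tsum_comm] at h4
  have h5 : pair (partSum 1) (mulRecip (mulRecip (mulRecip 1))) + zetaSum 5 =
      ∑' l, ∑' d, recip l ^ 3 * (recip d * recip (d + l + 1)) := by
    simp only [ENNReal.tsum_mul_left, tsum_recip_mul_recip_add_zero]
    rw [pair, zetaSum, ← ENNReal.tsum_add]
    refine tsum_congr fun n => ?_
    simp only [harm_eq, mulRecip, Pi.one_apply, Pi.add_apply]
    ring
  simp only [← key, ENNReal.tsum_add] at h5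
  rw [← h1, ← h2, ← h3, ← h4, add_comm] at h5
  refine (ENNReal.add_left_inj ?_).1 h5.symm
  -- Cancelling `ζ(4,1)` requires finiteness: `ζ(4,1) ≤ ζ(3,2) ≤ ζ(2)ζ(3)`.
  refine ne_top_of_le_ne_top (b := zetaSum 2 * zetaSum 3)
    (ENNReal.mul_ne_top (zetaSum_ne_top le_rfl) (zetaSum_ne_top (by norm_num))) ?_
  rw [zetaSum_two_mul_zetaSum_three, add_right_comm]
  refine le_trans ?_ le_add_self
  rw [h1, h2]
  refine ENNReal.tsum_le_tsum fun l => ENNReal.tsum_le_tsum fun d => ?_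
  have hle : recip (l + 1 + d) ≤ recip l := by
    rw [recip, recip]
    gcongr
    omega
  calc recip l * recip (l + 1 + d) ^ 4
      = recip l * recip (l + 1 + d) ^ 3 * recip (l + 1 + d) := by ring
    _ ≤ recip l * recip (l + 1 + d) ^ 3 * recip l := by gcongr
    _ = _ := by ring

theorem pair_harm_eval : pair (harm * partSum harm) (mulRecip 1) =
    2 * zetaSum 2 * zetaSum 3 + 2 * zetaSum 5 := by
  rw [pair_harm_mul_partSum_harm, mul_assoc, zetaSum_two_mul_zetaSum_three, ← sum_formula]
  ring

theorem tsum_harm_mul_innerSum : ∑' k, harm k * innerSum k * recip k ^ 2 =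
    4 * zetaSum 2 * zetaSum 3 + 2 * zetaSum 5 := by
  have h : ∑' k, harm k * innerSum k * recip k ^ 2 =
      zetaSum 2 * (∑' k, harm k * recip k ^ 2) + pair (harm * partSum harm) (mulRecip 1) := by
    rw [pair, ← ENNReal.tsum_mul_left, ← ENNReal.tsum_add]
    refine tsum_congr fun n => ?_
    have : innerSum n = zetaSum 2 + partSum harm n := by
      simp only [innerSum, partSum, mul_comm]
    simp only [this, mulRecip, Pi.one_apply, Pi.mul_apply]
    ring
  rw [h, tsum_harm_mul_recip_sq, pair_harm_eval]
  ring

theorem tsum_term_eq : (∑' k, ∑' j, term j k) + (4 * zetaSum 2 + 2 * zetaSum 3) =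
    4 * zetaSum 2 * zetaSum 3 + 2 * zetaSum 5 := by
  rw [← tsum_harm_mul_innerSum, ← tsum_term_add, tsum_harm_mul_recip_sq]

/-! ### Transfer to real numbers. -/

/-- The real value `ζ(k)`. -/
noncomputable def zetaReal (k : ℕ) : ℝ := ∑' n : ℕ, 1 / ((n : ℝ) + 1) ^ k

theorem summable_zetaReal {k : ℕ} (hk : 1 < k) : Summable fun n : ℕ => 1 / ((n : ℝ) + 1) ^ k := by
  have := (summable_nat_add_iff 1).2 (Real.summable_one_div_nat_pow.2 hk)
  simpa using this

theorem zetaSum_eq_ofReal {k : ℕ} (hk : 1 < k) : zetaSum k = ENNReal.ofReal (zetaReal k) := by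
  rw [zetaReal, ENNReal.ofReal_tsum_of_nonneg (fun n => by positivity) (summable_zetaReal hk)]
  refine tsum_congr fun n => ?_
  rw [recip_eq_ofReal, ← ENNReal.ofReal_pow (by positivity), one_div_pow]

theorem riemannZeta_eq_zetaReal {k : ℕ} (hk : 1 < k) : riemannZeta k = (zetaReal k : ℂ) := by
  rw [zeta_nat_eq_tsum_of_gt_one hk, zetaReal, Complex.ofReal_tsum,
    Summable.tsum_eq_zero_add]
  · simp [show k ≠ 0 by omega]
  · have := (Real.summable_one_div_nat_pow.2 hk)
    simpa using Complex.summable_ofReal.2 this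

theorem doubleTerm_nonneg (p : ℕ+ × ℕ+) : 0 ≤ doubleTerm p := by
  have h : (1 : ℝ) ≤ (harmonic ((p.2 : ℕ) + 1) : ℚ) := by
    rw [harmonic, Finset.sum_range_succ']
    push_cast
    simp only [inv_one, le_add_iff_nonneg_left]
    positivity
  have h2 : (0 : ℝ) ≤ (harmonic (p.1 : ℕ) : ℚ) := by
    rw [harmonic]
    positivity
  unfold doubleTerm
  have := sub_nonneg.2 h
  positivity

theorem harm_eq_ofReal (n : ℕ) : harm n = ENNReal.ofReal (harmonic (n + 1) : ℚ) := by
  rw [harm, harmonic]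
  push_cast
  rw [ENNReal.ofReal_sum_of_nonneg fun i _ => by positivity]
  exact Finset.sum_congr rfl fun i _ => by rw [recip_eq_ofReal, one_div]

theorem sum_recip_succ_eq_ofReal (n : ℕ) : ∑ l ∈ Finset.range (n + 1), recip (l + 1) =
    ENNReal.ofReal ((harmonic (n + 2) : ℚ) - 1) := by
  rw [harmonic, Finset.sum_range_succ' _ (n + 1)]
  push_cast
  rw [inv_one, add_sub_cancel_right, ENNReal.ofReal_sum_of_nonneg fun i _ => by positivity]
  exact Finset.sum_congr rfl fun i _ => by rw [recip_eq_ofReal, one_div]; push_cast; rfl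

theorem ofReal_doubleTerm (j k : ℕ) :
    ENNReal.ofReal (doubleTerm (j.succPNat, k.succPNat)) = term j k := by
  have h2 : (0 : ℝ) ≤ (harmonic (j + 1) : ℚ) := by
    rw [harmonic]
    positivity
  rw [term, harm_eq_ofReal, sum_recip_succ_eq_ofReal]
  simp only [recip_eq_ofReal]
  rw [← ENNReal.ofReal_mul h2, ← ENNReal.ofReal_mul (by positivity),
    ← ENNReal.ofReal_mul (by positivity), ← ENNReal.ofReal_mul (by positivity),
    ← ENNReal.ofReal_mul' (by positivity)]
  congr 1
  simp only [doubleTerm, Nat.succPNat_coe, Nat.succ_eq_add_one]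
  push_cast
  field_simp
  ring

theorem tsum_ofReal_doubleTerm :
    ∑' p, ENNReal.ofReal (doubleTerm p) = ∑' k, ∑' j, term j k := by
  rw [ENNReal.tsum_comm, ← ENNReal.tsum_prod,
    ← (Equiv.prodCongr Equiv.pnatEquivNat Equiv.pnatEquivNat).symm.tsum_eq]
  exact tsum_congr fun p => ofReal_doubleTerm p.1 p.2

theorem tsum_ofReal_doubleTerm_ne_top : ∑' p, ENNReal.ofReal (doubleTerm p) ≠ ⊤ := by
  rw [tsum_ofReal_doubleTerm]
  refine ne_top_of_le_ne_top ?_ (le_self_add.trans tsum_term_eq.le)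
  have h2 := zetaSum_ne_top (k := 2) le_rfl
  have h3 := zetaSum_ne_top (k := 3) (by norm_num)
  have h5 := zetaSum_ne_top (k := 5) (by norm_num)
  finiteness

theorem summable_doubleTerm : Summable doubleTerm := by
  have := ENNReal.summable_toReal tsum_ofReal_doubleTerm_ne_top
  simpa only [ENNReal.toReal_ofReal (doubleTerm_nonneg _)] using this

theorem doubleSum_eq : doubleSum = -4 * zetaReal 2 - 2 * zetaReal 3
    + 4 * zetaReal 2 * zetaReal 3 + 2 * zetaReal 5 := by
  have hz (k : ℕ) : 0 ≤ zetaReal k := tsum_nonneg fun n => by positivity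
  have hd : 0 ≤ doubleSum := tsum_nonneg doubleTerm_nonneg
  have h := tsum_term_eq
  rw [← tsum_ofReal_doubleTerm, ← ENNReal.ofReal_tsum_of_nonneg doubleTerm_nonneg
    summable_doubleTerm, zetaSum_eq_ofReal (by norm_num), zetaSum_eq_ofReal (by norm_num),
    zetaSum_eq_ofReal (by norm_num)] at h
  have h' := congrArg ENNReal.toReal h
  have e2 := hz 2
  have e3 := hz 3
  have e5 := hz 5
  rw [ENNReal.toReal_add (by finiteness) (by finiteness),
    ENNReal.toReal_add (by finiteness) (by finiteness),
    ENNReal.toReal_add (by finiteness) (by finiteness)] at h'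
  simp only [ENNReal.toReal_mul, ENNReal.toReal_ofReal, e2, e3, e5, ENNReal.toReal_ofNat] at h'
  change (ENNReal.ofReal doubleSum).toReal + _ = _ at h'
  rw [ENNReal.toReal_ofReal hd] at h'
  linarith

/-! ### Numerical bounds. -/

theorem tsum_le_of_le_telescope {f v : ℕ → ℝ} (hf : Summable f) (N : ℕ)
    (h : ∀ n, f n ≤ v n - v (n + 1)) (hv : Filter.Tendsto v Filter.atTop (nhds 0)) :
    ∑' n, f n ≤ ∑ n ∈ Finset.range N, f n + v N := by
  have h1 : ∀ M ≥ N, ∑ n ∈ Finset.range M, f n ≤ ∑ n ∈ Finset.range N, f n + v N - v M := by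
    intro M hM
    induction M, hM using Nat.le_induction with
    | base => simp
    | succ M _ ih =>
      rw [Finset.sum_range_succ]
      linarith [h M]
  have h2 := hv.const_sub (∑ n ∈ Finset.range N, f n + v N)
  rw [sub_zero] at h2
  exact le_of_tendsto_of_tendsto hf.hasSum.tendsto_sum_nat h2
    (Filter.eventually_atTop.2 ⟨N, h1⟩)

theorem le_tsum_of_telescope_le {f v : ℕ → ℝ} (hf : Summable f) (N : ℕ)
    (h : ∀ n, v n - v (n + 1) ≤ f n) (hv : Filter.Tendsto v Filter.atTop (nhds 0)) :
    ∑ n ∈ Finset.range N, f n + v N ≤ ∑' n, f n := by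
  have := tsum_le_of_le_telescope (f := fun n => -f n) (v := fun n => -v n) hf.neg N
    (fun n => by linarith [h n]) (by simpa using hv.neg)
  rw [tsum_neg, Finset.sum_neg_distrib] at this
  linarith

theorem tendsto_one_div_succ_pow (c : ℝ) {k : ℕ} (hk : k ≠ 0) :
    Filter.Tendsto (fun n : ℕ => c * (1 / ((n : ℝ) + 1)) ^ k) Filter.atTop (nhds 0) := by
  simpa [hk] using ((tendsto_one_div_add_atTop_nhds_zero_nat (𝕜 := ℝ)).pow k).const_mul c

/-- Here `v` is the Euler–Maclaurin tail, whose truncations alternately over- and underestimate; the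
two lower bounds below use it too. -/
theorem zetaReal_three_lt : zetaReal 3 < 1.20205691 := by
  refine (tsum_le_of_le_telescope (summable_zetaReal (by norm_num)) 15
    (v := fun n => 1 / 2 * (1 / ((n : ℝ) + 1)) ^ 2 + 1 / 2 * (1 / ((n : ℝ) + 1)) ^ 3
      + 1 / 4 * (1 / ((n : ℝ) + 1)) ^ 4) (fun n => ?_) ?_).trans_lt ?_
  · rw [← sub_nonneg]
    have : 0 ≤ (2 * ((n : ℝ) + 1) + 1) / (4 * (n + 1) ^ 4 * (n + 2) ^ 4) := by positivity
    convert! this using 1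
    push_cast
    field_simp
    ring
  · simpa using ((tendsto_one_div_succ_pow (1 / 2) two_ne_zero).add
      (tendsto_one_div_succ_pow (1 / 2) three_ne_zero)).add
      (tendsto_one_div_succ_pow (1 / 4) four_ne_zero)
  · norm_num [Finset.sum_range_succ]

theorem lt_zetaReal_three : 1.2020569 < zetaReal 3 := by
  refine lt_of_lt_of_le ?_ (le_tsum_of_telescope_le (summable_zetaReal (by norm_num)) 15
    (v := fun n => 1 / 2 * (1 / ((n : ℝ) + 1)) ^ 2 + 1 / 2 * (1 / ((n : ℝ) + 1)) ^ 3
      + 1 / 4 * (1 / ((n : ℝ) + 1)) ^ 4 + -(1 / 12) * (1 / ((n : ℝ) + 1)) ^ 6) (fun n => ?_) ?_)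
  · norm_num [Finset.sum_range_succ]
  · rw [← sub_nonneg]
    have : 0 ≤ (8 * ((n : ℝ) + 1) ^ 3 + 12 * (n + 1) ^ 2 + 6 * (n + 1) + 1) /
      (12 * (n + 1) ^ 6 * (n + 2) ^ 6) := by positivity
    convert! this using 1
    push_cast
    field_simp
    ring
  · simpa using (((tendsto_one_div_succ_pow (1 / 2) two_ne_zero).add
      (tendsto_one_div_succ_pow (1 / 2) three_ne_zero)).add
      (tendsto_one_div_succ_pow (1 / 4) four_ne_zero)).add
      (tendsto_one_div_succ_pow (-(1 / 12)) (by norm_num : 6 ≠ 0))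

theorem lt_zetaReal_five : 1.0369277 < zetaReal 5 := by
  refine lt_of_lt_of_le ?_ (le_tsum_of_telescope_le (summable_zetaReal (by norm_num)) 15
    (v := fun n => 1 / 4 * (1 / ((n : ℝ) + 1)) ^ 4 + 1 / 2 * (1 / ((n : ℝ) + 1)) ^ 5)
    (fun n => ?_) ?_)
  · norm_num [Finset.sum_range_succ]
  · rw [← sub_nonneg]
    have : 0 ≤ (10 * ((n : ℝ) + 1) ^ 3 + 15 * (n + 1) ^ 2 + 9 * (n + 1) + 2) /
      (4 * (n + 1) ^ 5 * (n + 2) ^ 5) := by positivity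
    convert! this using 1
    push_cast
    field_simp
    ring
  · simpa using (tendsto_one_div_succ_pow (1 / 4) four_ne_zero).add
      (tendsto_one_div_succ_pow (1 / 2) (by norm_num : 5 ≠ 0))

theorem zetaReal_five_lt : zetaReal 5 < 1.03692778 := by
  refine (tsum_le_of_le_telescope (summable_zetaReal (by norm_num)) 15
    -- `v n` is the integral of `t⁻⁵` from `n + 1/2` to infinity, an upper bound for the tail by
    -- convexity.
    (v := fun n => 4 / (2 * (n : ℝ) + 1) ^ 4) (fun n => ?_) ?_).trans_lt ?_
  · rw [← sub_nonneg]
    have : 0 ≤ (320 * ((n : ℝ) + 1) ^ 6 - 96 * (n + 1) ^ 4 + 16 * (n + 1) ^ 2 - 1) /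
        ((n + 1) ^ 5 * (2 * n + 1) ^ 4 * (2 * n + 3) ^ 4) := by
      refine div_nonneg ?_ (by positivity)
      ring_nf
      positivity
    convert! this using 1
    push_cast
    field_simp
    ring
  · refine squeeze_zero (fun n => by positivity) (fun n => ?_)
      (tendsto_one_div_succ_pow 4 one_ne_zero)
    rw [pow_one, mul_one_div]
    gcongr
    calc (n : ℝ) + 1 ≤ 2 * n + 1 := by linarith [(by positivity : (0 : ℝ) ≤ n)]
      _ ≤ _ := le_self_pow₀ (by linarith [(by positivity : (0 : ℝ) ≤ n)]) four_ne_zero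
  · norm_num [Finset.sum_range_succ]

theorem zetaReal_two : zetaReal 2 = Real.pi ^ 2 / 6 := by
  have h := riemannZeta_eq_zetaReal (k := 2) (by norm_num)
  rw [Nat.cast_ofNat, riemannZeta_two] at h
  exact_mod_cast h.symm

theorem lt_zetaReal_two : 1.6449340 < zetaReal 2 := by
  rw [zetaReal_two]
  have := Real.pi_gt_d20
  nlinarith

theorem zetaReal_two_lt : zetaReal 2 < 1.6449341 := by
  rw [zetaReal_two]
  have := Real.pi_lt_d20
  have := Real.pi_pos
  nlinarith

/-- Near these values the closed form increases in each of `ζ(2)`, `ζ(3)`, `ζ(5)`, so lower bounds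
on them suffice. -/
theorem le_doubleSum : 0.999222 ≤ doubleSum := by
  rw [doubleSum_eq]
  nlinarith [lt_zetaReal_two, lt_zetaReal_three, lt_zetaReal_five]

theorem doubleSum_lt : doubleSum < 0.999223 := by
  rw [doubleSum_eq]
  nlinarith [lt_zetaReal_two, zetaReal_two_lt, zetaReal_three_lt, zetaReal_five_lt]

end HarmonicSeries

theorem theorem1 :
    Summable doubleTerm ∧
    (doubleSum : ℂ) =
      -4 * riemannZeta 2 - 2 * riemannZeta 3 + 4 * riemannZeta 2 * riemannZeta 3
        + 2 * riemannZeta 5 ∧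
    (0.999222 : ℝ) ≤ doubleSum ∧ doubleSum < (0.999223 : ℝ) ∧
    doubleSum ≠ 1 := by
  have h2 := HarmonicSeries.riemannZeta_eq_zetaReal (k := 2) (by norm_num)
  have h3 := HarmonicSeries.riemannZeta_eq_zetaReal (k := 3) (by norm_num)
  have h5 := HarmonicSeries.riemannZeta_eq_zetaReal (k := 5) (by norm_num)
  rw [Nat.cast_ofNat] at h2 h3 h5
  refine ⟨HarmonicSeries.summable_doubleTerm, ?_, HarmonicSeries.le_doubleSum,
    HarmonicSeries.doubleSum_lt, ?_⟩
  · rw [HarmonicSeries.doubleSum_eq, h2, h3, h5]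
    push_cast
    ring
  · have := HarmonicSeries.doubleSum_lt
    intro h
    norm_num [h] at this
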